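/- Consider a fixed-gain amplify-and-forward link with $N\ge 2$ hops, channel coefficients $h_1,\dots,h_N$, fixed real gains $A_0,\dots,A_{N-1}$ and noise scaling factors $\rho_1,\dots,\rho_N>0$. Put $X_n=A_{n-1}^2|h_n|^2$ and $$\mathsf{SNR}=\frac{\prod_{n=1}^N X_n}{\sum_{n=1}^N\rho_n\prod_{j=n+1}^N X_j}\,\bar\gamma ,\qquad P_o(\bar\gamma)=P(\mathsf{SNR}<\gamma_{th}),\qquad \gamma_{th}>0 .$$ Assume that $X_1,\dots,X_N$ are independent and that $X_n$ has the Hoyt power density with parameters $q_n>0$, $\theta_n>0$, $$f_{X_n}(x)=\frac{1+q_n^2}{2q_n\theta_n}\,e^{-\frac{(1+q_n^2)^2}{4q_n^2\theta_n}x}\,I_0\!\left(\frac{1-q_n^4}{4q_n^2\theta_n}x\right),\quad x\ge 0,$$ where $I_0(x)=\sum_{k\ge0}(x/2)^{2k}/(k!)^2$. Fix integers $L_1,\dots,L_{N-1}\ge 1$. For $\boldsymbol\ell=(\ell_1,\dots,\ell_{N-1})$ with $0\le\ell_k\le L_k-1$ put $\lambda_n=\sum_{k=1}^n\ell_k$ (so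 $\lambda_0=0$). For $1\le r\le N$ let $\mathcal L_r$ be the set of those $\boldsymbol\ell$ with $\lambda_{r-1}=0$ and, if $r\le N-1$, $\lambda_r>0$. Put $$\chi_{\boldsymbol\ell}=\left(\frac{2q_N}{1+q_N^2}\right)^{1+2\lambda_{N-1}}\prod_{n=1}^{N-1}\frac{\theta_{n+1}^{\lambda_n}}{\ell_n!}\left(\frac{\rho_n}{\rho_N}\right)^{\ell_n}\left(\frac{2q_n}{1+q_n^2}\right)^{1+2\lambda_{n-1}},$$ $$\eta(s)=\eta_{r,\boldsymbol\ell}(s)=(s-1)^r\frac{\Gamma(\lambda_{N-1}-s)}{\Gamma(1-s)}\prod_{n=1}^N\Gamma(1+\lambda_{n-1}-s)\;{}_2F_1\!\left(\tfrac{1+\lambda_{n-1}-s}{2},\tfrac{2+\lambda_{n-1}-s}{2};1;\left(\tfrac{1-q_n^2}{1+q_n^2}\right)^2\right).$$ Then for all $1\le r\le N$, $\boldsymbol\ell\in\mathcal L_r$ and $0\le k<r$ the limit $\eta^{(k)}(1):=\lim_{s\to1,\,s\ne1}\eta^{(k)}(s)$ exists, and with $$B=\frac{\rho_N\gamma_{th}\prod_{n=1}^N(1+q_n^2)^2}{\prod_{n=1}^N4q_n^2\theta_n}$$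 the outage probability satisfies, as $\bar\gamma\to\infty$, $$P_o(\bar\gamma)\sim B\sum_{r=1}^N\sum_{\boldsymbol\ell\in\mathcal L_r}(-1)^{\lambda_{N-1}}\chi_{\boldsymbol\ell}\sum_{l=0}^{r-1}\frac{\eta^{(r-1-l)}(1)}{(r-1-l)!\,l!}\sum_{p=0}^l\binom lp(-1)^p(\log B)^{l-p}\,\frac{(\log\bar\gamma)^p}{\bar\gamma}$$ and, to leading order, $$P_o(\bar\gamma)\sim\frac{\rho_N\gamma_{th}}{(N-1)!}\prod_{n=1}^N\frac{1+q_n^2}{2q_n\theta_n}\;\frac{(\log\bar\gamma)^{N-1}}{\bar\gamma}.$$ Here $f\sim g$ denotes asymptotic equivalence: $f-g=o(g)$ as $\bar\gamma\to\infty$. -/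

import Mathlib

open MeasureTheory ProbabilityTheory Filter Topology Asymptotics

noncomputable section

namespace HoytRelay

/-! Throughout, `M` is the number of relays, so that the link has `N = M + 1` hops. The `n`-th hop,
`1 ≤ n ≤ N`, is the element `n - 1` of `Fin (M + 1)`; the summation index `ℓ_k`, `1 ≤ k ≤ N - 1`,
is the entry `k - 1` of a vector indexed by `Fin M`. -/

/-- The modified Bessel function of the first kind of order zero,
`I₀(x) = ∑ (x / 2) ^ (2 k) / (k!) ^ 2`. -/
def besselI0 (x : ℝ) : ℝ :=
  ∑' k : ℕ, (x / 2) ^ (2 * k) / (k.factorial : ℝ) ^ 2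

/-- The Hoyt (Nakagami-`q`) channel power density with fading parameter `q` and scale `θ`. -/
def hoytPDF (q θ x : ℝ) : ℝ :=
  if 0 ≤ x then
    (1 + q ^ 2) / (2 * q * θ) * Real.exp (-((1 + q ^ 2) ^ 2 / (4 * q ^ 2 * θ) * x)) *
      besselI0 ((1 - q ^ 4) / (4 * q ^ 2 * θ) * x)
  else 0

/-- The Hoyt channel power distribution. -/
def hoytMeasure (q θ : ℝ) : Measure ℝ :=
  volume.withDensity fun x => ENNReal.ofReal (hoytPDF q θ x)

section Link

variable {Ω : Type*} {M : ℕ}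

/-- The power `X_n = A_{n-1} ^ 2 |h_n| ^ 2` of the `n`-th hop. The entry `n - 1` of `A` is the
gain `A_{n-1}` of the transmitter of the `n`-th hop, and the entry `n - 1` of `h` is the channel
coefficient `h_n`. -/
def hopPower (A : Fin (M + 1) → ℝ) (h : Fin (M + 1) → Ω → ℂ) (n : Fin (M + 1)) (ω : Ω) : ℝ :=
  A n ^ 2 * ‖h n ω‖ ^ 2

/-- The instantaneous end-to-end signal-to-noise ratio of the fixed-gain link,
`∏ X_n / (∑ ρ_n ∏_{j > n} X_j) * γ`. -/
def snr (A ρ : Fin (M + 1) → ℝ) (h : Fin (M + 1) → Ω → ℂ) (γ : ℝ) (ω : Ω) : ℝ :=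
  (∏ n, hopPower A h n ω) / (∑ n, ρ n * ∏ j ∈ Finset.Ioi n, hopPower A h j ω) * γ

/-- The outage probability `P(SNR < γth)` at reference signal-to-noise ratio `γ`. -/
def outage [MeasurableSpace Ω] (P : Measure Ω) (A ρ : Fin (M + 1) → ℝ)
    (h : Fin (M + 1) → Ω → ℂ) (γth γ : ℝ) : ℝ :=
  P.real {ω | snr A ρ h γ ω < γth}

end Link

section Expansion

variable {M : ℕ}

/-- `lam ℓ n = λ_n = ℓ_1 + ⋯ + ℓ_n`. -/
def lam (ℓ : Fin M → ℕ) (n : ℕ) : ℕ :=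
  ∑ k : Fin M with k.val < n, ℓ k

/-- The set `𝓛_r`, `1 ≤ r ≤ N`: the index vectors `ℓ` with `0 ≤ ℓ_k ≤ L_k - 1` for all `k`, with
`λ_{r-1} = 0` and, if `r ≤ N - 1`, with `λ_r > 0`. -/
def indexSet (L : Fin M → ℕ) (r : ℕ) : Finset (Fin M → ℕ) :=
  {ℓ ∈ Fintype.piFinset fun k => Finset.range (L k) |
    lam ℓ (r - 1) = 0 ∧ (r ≤ M → 0 < lam ℓ r)}

/-- The coefficient `χ_ℓ`. -/
def chi (ρ q θ : Fin (M + 1) → ℝ) (ℓ : Fin M → ℕ) : ℝ :=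
  (2 * q (Fin.last M) / (1 + q (Fin.last M) ^ 2)) ^ (1 + 2 * lam ℓ M) *
    ∏ k : Fin M, θ k.succ ^ lam ℓ (k + 1) / ((ℓ k).factorial : ℝ) *
      (ρ k.castSucc / ρ (Fin.last M)) ^ ℓ k *
      (2 * q k.castSucc / (1 + q k.castSucc ^ 2)) ^ (1 + 2 * lam ℓ k)

/-- The function `η(s)`, for `s` near but different from `1`. -/
def eta (q : Fin (M + 1) → ℝ) (ℓ : Fin M → ℕ) (r : ℕ) (s : ℝ) : ℝ :=
  (s - 1) ^ r * (Real.Gamma (lam ℓ M - s) / Real.Gamma (1 - s)) *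
    ∏ n : Fin (M + 1), Real.Gamma (1 + lam ℓ n - s) *
      ₂F₁ ((1 + lam ℓ n - s) / 2) ((2 + lam ℓ n - s) / 2) (1 : ℝ)
        (((1 - q n ^ 2) / (1 + q n ^ 2)) ^ 2)

/-- The value `η^{(k)}(1)`. The defining formula of `η` is not meaningful at the removable
singularity `s = 1` itself, so this is the limit of `η^{(k)}(s)` as `s → 1`, `s ≠ 1`. -/
def etaDeriv (q : Fin (M + 1) → ℝ) (ℓ : Fin M → ℕ) (r k : ℕ) : ℝ :=
  limUnder (𝓝[≠] (1 : ℝ)) (iteratedDeriv k (eta q ℓ r))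

/-- The constant `ρ_N γth ∏ (1 + q_n ^ 2) ^ 2 / ∏ (4 q_n ^ 2 θ_n)`. -/
def scale (ρ q θ : Fin (M + 1) → ℝ) (γth : ℝ) : ℝ :=
  ρ (Fin.last M) * γth * (∏ n, (1 + q n ^ 2) ^ 2) / ∏ n, 4 * q n ^ 2 * θ n

/-- The high-SNR expansion of the outage probability in the functions `(log γ) ^ p / γ`. -/
def expansion (ρ q θ : Fin (M + 1) → ℝ) (γth : ℝ) (L : Fin M → ℕ) (γ : ℝ) : ℝ :=
  scale ρ q θ γth *
    ∑ r ∈ Finset.Icc 1 (M + 1), ∑ ℓ ∈ indexSet L r,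
      (-1) ^ lam ℓ M * chi ρ q θ ℓ *
        ∑ l ∈ Finset.range r,
          etaDeriv q ℓ r (r - 1 - l) / (((r - 1 - l).factorial : ℝ) * (l.factorial : ℝ)) *
            ∑ p ∈ Finset.range (l + 1),
              (l.choose p : ℝ) * (-1) ^ p * Real.log (scale ρ q θ γth) ^ (l - p) *
                (Real.log γ ^ p / γ)

/-- The leading-order term of the outage probability. -/
def leading (ρ q θ : Fin (M + 1) → ℝ) (γth : ℝ) (γ : ℝ) : ℝ :=
  ρ (Fin.last M) * γth / (M.factorial : ℝ) *
    (∏ n, (1 + q n ^ 2) / (2 * q n * θ n)) * (Real.log γ ^ M / γ)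

end Expansion

end HoytRelay

end

/-! Asymptotic equivalence sees only the dominant term, so outage probability and expansion are each
shown, after division by `Real.log γ ^ M / γ`, to have the same nonzero limit.

For the outage, only the right limits `c n` of the hop densities at the origin matter. If `P(Y < t)
∼ C t (log 1/t)^m` and `X` is independent of `Y` with density `f`, then `P(XY < t) = ∫ f(x) P(Y <
t/x) dx`. The bulk comes from small `x` well above `t`, where the integrand is about `f(0+) C (t/x)
log(x/t)^m`; integration raises the log power by one and divides by `m + 1`. Induction gives
`logTail_prod`, with the factorial in the leading constant. The outage event is then squeezed: it
contains a lower-tail event of the full product and lies in the union of a slightly larger one and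
lower-tail events of proper partial products, which carry fewer logarithms (`prod_lt_of_prod_lt`,
`exists_prod_lt_of_snr_lt`).

In the expansion, `(log γ)^M` occurs only for `r = M + 1`, `ℓ = 0`, `l = p = M`, with coefficient
given by `etaDeriv_zero`. The derivative limits exist because `(s - 1)^r` cancels the poles of `η`,
leaving a smooth function (`hasSmoothExt_eta`). -/

namespace HoytRelay

section SmoothExtension

open scoped ContDiff Nat

/-! ### Smooth extension across the removable singularity `s = 1` -/

/-- `f` agrees near, but not necessarily at, the point `1` with a smooth function whose value at
`1` is `c`. -/
def HasSmoothExt (f : ℝ → ℝ) (c : ℝ) : Prop :=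
  ∃ g : ℝ → ℝ, ContDiffAt ℝ ∞ g 1 ∧ f =ᶠ[𝓝[≠] 1] g ∧ g 1 = c

lemma HasSmoothExt.of_contDiffAt {f : ℝ → ℝ} (hf : ContDiffAt ℝ ∞ f 1) : HasSmoothExt f (f 1) :=
  ⟨f, hf, EventuallyEq.rfl, rfl⟩

lemma HasSmoothExt.congr {f g : ℝ → ℝ} {c : ℝ} (hf : HasSmoothExt f c) (h : g =ᶠ[𝓝[≠] 1] f) :
    HasSmoothExt g c := by
  obtain ⟨k, hk, hfk, hc⟩ := hf
  exact ⟨k, hk, h.trans hfk, hc⟩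

lemma HasSmoothExt.mul {f g : ℝ → ℝ} {c d : ℝ} (hf : HasSmoothExt f c) (hg : HasSmoothExt g d) :
    HasSmoothExt (fun s => f s * g s) (c * d) := by
  obtain ⟨f', hf', hff', rfl⟩ := hf
  obtain ⟨g', hg', hgg', rfl⟩ := hg
  exact ⟨fun s => f' s * g' s, hf'.mul hg', hff'.mul hgg', rfl⟩

lemma HasSmoothExt.prod {ι : Type*} (t : Finset ι) {f : ι → ℝ → ℝ} {c : ι → ℝ}
    (hf : ∀ i ∈ t, HasSmoothExt (f i) (c i)) :
    HasSmoothExt (fun s => ∏ i ∈ t, f i s) (∏ i ∈ t, c i) := by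
  classical
  induction t using Finset.induction_on with
  | empty => simpa using HasSmoothExt.of_contDiffAt (f := fun _ => (1 : ℝ)) contDiffAt_const
  | insert a t ha ih =>
    simp only [Finset.prod_insert ha]
    exact (hf a (Finset.mem_insert_self a t)).mul
      (ih fun i hi => hf i (Finset.mem_insert_of_mem hi))

lemma HasSmoothExt.tendsto {f : ℝ → ℝ} {c : ℝ} (hf : HasSmoothExt f c) :
    Tendsto f (𝓝[≠] 1) (𝓝 c) := by
  obtain ⟨g, hg, hfg, rfl⟩ := hf
  exact (hg.continuousAt.tendsto.mono_left nhdsWithin_le_nhds).congr' hfg.symm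

/-- A punctured neighbourhood is open, so `f` and its extension agree near each of its points and
share all derivatives there; those of the extension are continuous at `1`. -/
lemma HasSmoothExt.exists_tendsto_iteratedDeriv {f : ℝ → ℝ} {c : ℝ} (hf : HasSmoothExt f c)
    (k : ℕ) : ∃ a, Tendsto (iteratedDeriv k f) (𝓝[≠] 1) (𝓝 a) := by
  obtain ⟨g, hg, hfg, -⟩ := hf
  refine ⟨iteratedDeriv k g 1, ?_⟩
  have hcont : ContinuousAt (iteratedDeriv k g) 1 := by
    have h : ContDiffAt ℝ (k + 1 : ℕ) g 1 := hg.of_le (by exact_mod_cast le_top)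
    obtain ⟨u, hu, hgu⟩ := h.contDiffOn le_rfl (by simp)
    obtain ⟨v, hvu, hv, h1v⟩ := mem_nhds_iff.1 (by simpa using hu : u ∈ 𝓝 (1 : ℝ))
    have hc : ContinuousOn (iteratedDerivWithin k g v) v :=
      (hgu.mono hvu).continuousOn_iteratedDerivWithin (by exact_mod_cast k.le_succ)
        hv.uniqueDiffOn
    exact ((hc.congr fun x hx => (iteratedDerivWithin_of_isOpen hv hx).symm).continuousAt
      (hv.mem_nhds h1v))
  refine (hcont.tendsto.mono_left nhdsWithin_le_nhds).congr' ?_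
  have h2 : ∀ᶠ x in 𝓝[≠] (1 : ℝ), f =ᶠ[𝓝 x] g := by
    have := eventually_eventually_nhdsWithin.2 hfg
    filter_upwards [this, self_mem_nhdsWithin] with x hx hx1
    rwa [isOpen_compl_singleton.nhdsWithin_eq hx1] at hx
  filter_upwards [h2] with x hx
  exact (hx.iteratedDeriv_eq k).symm

/-! ### Smoothness of the Gamma and hypergeometric factors -/

lemma contDiffAt_Gamma {x : ℝ} (hx : 0 < x) : ContDiffAt ℝ ∞ Real.Gamma x := by
  have h : ContDiffAt ℂ ∞ Complex.Gamma (x : ℂ) := by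
    refine AnalyticAt.contDiffAt ?_
    rw [Complex.analyticAt_iff_eventually_differentiableAt]
    have : ∀ᶠ z : ℂ in 𝓝 (x : ℂ), 0 < z.re :=
      Complex.continuous_re.continuousAt.eventually (lt_mem_nhds (by simpa using hx))
    filter_upwards [this] with z hz
    refine Complex.differentiableAt_Gamma z fun m hm => ?_
    rw [hm] at hz
    have : (0 : ℝ) ≤ m := m.cast_nonneg
    simp at hz
    linarith
  simpa [Complex.Gamma_ofReal] using h.real_of_complex

lemma norm_ascPochhammer_eval_le {a : ℂ} {A : ℝ} (h : ‖a‖ ≤ A) (k : ℕ) :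
    ‖(ascPochhammer ℂ k).eval a‖ ≤ (ascPochhammer ℝ k).eval A := by
  induction k with
  | zero => simp
  | succ k ih =>
    rw [ascPochhammer_succ_eval, ascPochhammer_succ_eval, norm_mul]
    have : ‖a + k‖ ≤ A + k := (norm_add_le _ _).trans (by simpa using h)
    exact mul_le_mul ih this (norm_nonneg _) ((norm_nonneg _).trans ih)

lemma summable_hypergeometric_majorant (m : ℕ) {z : ℝ} (hz : |z| < 1) :
    Summable fun k : ℕ => ‖((k ! : ℝ)⁻¹ * (ascPochhammer ℝ k).eval (m + 1 : ℝ) *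
      (ascPochhammer ℝ k).eval (m + 1 : ℝ) * ((ascPochhammer ℝ k).eval (1 : ℝ))⁻¹) • z ^ k‖ := by
  have hr := ordinaryHypergeometricSeries_radius_eq_one (𝔸 := ℝ) (𝕂 := ℝ) (m + 1 : ℝ) (m + 1) 1
    (fun k => by
      have : (0 : ℝ) ≤ k := k.cast_nonneg
      have : (0 : ℝ) ≤ m := m.cast_nonneg
      refine ⟨?_, ?_, ?_⟩ <;> intro h <;> linarith)
  have := (ordinaryHypergeometricSeries ℝ (m + 1 : ℝ) (m + 1) 1).summable_norm_apply (x := z)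
    (by rw [hr]; simpa [enorm_eq_nnnorm, ← NNReal.coe_lt_coe] using hz)
  simpa only [ordinaryHypergeometricSeries_apply_eq] using this

/-- The variable sits in the parameters, so `s` is made complex: the series converges normally on
the unit disc about `1`, its sum is holomorphic, and restriction to the real line is smooth. -/
lemma contDiffAt_hypergeometric (m : ℕ) {z : ℝ} (hz : |z| < 1) :
    ContDiffAt ℝ ∞ (fun s : ℝ => ₂F₁ ((1 + m - s) / 2) ((2 + m - s) / 2) (1 : ℝ) z) 1 := by
  let F : ℂ → ℂ := fun w => ∑' k : ℕ, ((k ! : ℂ)⁻¹ * (ascPochhammer ℂ k).eval ((1 + m - w) / 2) *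
      (ascPochhammer ℂ k).eval ((2 + m - w) / 2) * ((ascPochhammer ℂ k).eval (1 : ℂ))⁻¹) * z ^ k
  have hF : DifferentiableOn ℂ F (Metric.ball 1 1) := by
    refine Complex.differentiableOn_tsum_of_summable_norm
      (summable_hypergeometric_majorant (m + 1) hz) (fun k => ?_) Metric.isOpen_ball ?_
    · refine Differentiable.differentiableOn ?_
      have (a : ℂ) : Differentiable ℂ fun w : ℂ => (ascPochhammer ℂ k).eval ((a - w) / 2) :=
        (ascPochhammer ℂ k).differentiable.comp
          (((differentiable_const a).sub differentiable_id).div_const 2)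
      exact ((((this _).const_mul _).mul (this _)).mul_const _).mul_const _
    · intro k w hw
      -- On the disc both parameters have norm at most `m + 2`, hence the majorant with `m + 1` in
      -- place of `m`.
      have hb (a : ℕ) (ha : a ≤ 2) :
          ‖(a + m - w) / 2‖ ≤ ((m + 1 : ℕ) : ℝ) + 1 := by
        have hw' : ‖w - 1‖ < 1 := by simpa [dist_eq_norm] using hw
        have e : (a + m - w : ℂ) = ((a + m : ℕ) : ℂ) - 1 - (w - 1) := by push_cast; ring
        have h1 : ‖(a + m - w : ℂ)‖ ≤ (a + m : ℕ) + 1 + 1 := by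
          rw [e]
          refine (norm_sub_le _ _).trans (add_le_add ((norm_sub_le _ _).trans ?_) hw'.le)
          rw [Complex.norm_natCast, norm_one]
        have ha' : (a : ℝ) ≤ 2 := by exact_mod_cast ha
        have hm : (0 : ℝ) ≤ m := m.cast_nonneg
        rw [norm_div]
        push_cast at h1 ⊢
        simp only [Complex.norm_ofNat]
        linarith
      have h1 := norm_ascPochhammer_eval_le (a := (1 + m - w) / 2)
        (mod_cast hb 1 (by norm_num)) k
      have h2 := norm_ascPochhammer_eval_le (a := (2 + m - w) / 2) (mod_cast hb 2 le_rfl) k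
      have h0 := (norm_nonneg _).trans h1
      have hk : (ascPochhammer ℂ k).eval (1 : ℂ) = (k ! : ℂ) := by
        rw [ascPochhammer_eval_one]
      have hk' : (ascPochhammer ℝ k).eval (1 : ℝ) = (k ! : ℝ) := by
        rw [ascPochhammer_eval_one]
      rw [hk, hk', smul_eq_mul]
      simp only [norm_mul, norm_inv, norm_pow, Complex.norm_natCast, Complex.norm_real,
        Real.norm_natCast, Nat.cast_add, Nat.cast_one] at h0 h1 h2 ⊢
      rw [Real.norm_of_nonneg h0]
      gcongr
  have hA : ContDiffAt ℂ ∞ F ((1 : ℝ) : ℂ) := by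
    refine AnalyticAt.contDiffAt ?_
    exact hF.analyticAt (by simpa using Metric.ball_mem_nhds (1 : ℂ) one_pos)
  have := hA.real_of_complex
  refine this.congr_of_eventuallyEq (Eventually.of_forall fun s => ?_)
  simp only []
  rw [ordinaryHypergeometric_eq_tsum]
  have (a : ℝ) (k : ℕ) : (ascPochhammer ℂ k).eval (a : ℂ) = ((ascPochhammer ℝ k).eval a : ℝ) := by
    induction k with
    | zero => simp
    | succ k ih => rw [ascPochhammer_succ_eval, ascPochhammer_succ_eval, ih]; push_cast; ring
  have h1 := this ((1 + m - s) / 2)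
  have h2 := this ((2 + m - s) / 2)
  have h3 := this 1
  push_cast at h1 h2 h3
  simp only [F, h1, h2, h3, smul_eq_mul]
  rw [← Complex.ofReal_re (∑' _, _), Complex.ofReal_tsum]
  push_cast
  rfl

/-- For `n < r` the simple pole is removed by `(s - 1) Γ(1 - s) = -Γ(2 - s)`; otherwise the argument
is positive at `s = 1` and there is no pole. -/
lemma hasSmoothExt_Gamma_mul (m r n : ℕ) (h0 : n < r → m = 0) (h1 : r ≤ n → 0 < m) :
    HasSmoothExt (fun s => (if n < r then s - 1 else 1) * Real.Gamma (1 + m - s))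
      (if n < r then -1 else Real.Gamma m) := by
  by_cases hn : n < r
  · simp only [hn, if_true, h0 hn]
    have hG : ContDiffAt ℝ ∞ (fun s : ℝ => -Real.Gamma (2 - s)) 1 :=
      (ContDiffAt.comp (1 : ℝ) (g := Real.Gamma) (f := fun s : ℝ => 2 - s)
        (contDiffAt_Gamma (by norm_num)) (contDiffAt_const.sub contDiffAt_id)).neg
    have := HasSmoothExt.of_contDiffAt hG
    norm_num at this
    refine this.congr ?_
    filter_upwards [self_mem_nhdsWithin] with s hs
    have hs' : (1 : ℝ) - s ≠ 0 := sub_ne_zero.2 (Ne.symm hs)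
    have := Real.Gamma_add_one hs'
    rw [show (2 : ℝ) - s = 1 - s + 1 by ring, this]
    simp; ring
  · simp only [hn, if_false, one_mul]
    have hm : (0 : ℝ) < m := by exact_mod_cast h1 (not_lt.1 hn)
    have := HasSmoothExt.of_contDiffAt (f := fun s : ℝ => Real.Gamma (1 + m - s))
      (ContDiffAt.comp (1 : ℝ) (g := Real.Gamma) (f := fun s : ℝ => 1 + m - s)
        (contDiffAt_Gamma (by simpa using hm)) (contDiffAt_const.sub contDiffAt_id))
    simpa using this

lemma Gamma_sub_ne_zero {s : ℝ} (h0 : 0 < s) (h2 : s < 2) (h1 : s ≠ 1) (j : ℤ) :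
    Real.Gamma (j - s) ≠ 0 := by
  refine Real.Gamma_ne_zero fun m hm => h1 ?_
  have e : s = ((j + m : ℤ) : ℝ) := by push_cast; linarith
  rw [e] at h0 h2 ⊢
  have a : 0 < j + m := by exact_mod_cast h0
  have b : j + m < 2 := by exact_mod_cast h2
  have : j + m = 1 := by omega
  rw [this]; simp

lemma eventually_punctured_one : ∀ᶠ s : ℝ in 𝓝[≠] 1, 0 < s ∧ s < 2 ∧ s ≠ 1 := by
  filter_upwards [self_mem_nhdsWithin,
    mem_nhdsWithin_of_mem_nhds (Ioo_mem_nhds (zero_lt_one (α := ℝ)) one_lt_two)] with s hs hs'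
  exact ⟨hs'.1, hs'.2, hs⟩

lemma hasSmoothExt_Gamma_ratio_zero :
    HasSmoothExt (fun s => Real.Gamma ((0 : ℕ) - s) / Real.Gamma (1 - s)) (-1) := by
  have := HasSmoothExt.of_contDiffAt (f := fun s : ℝ => -s⁻¹) (contDiffAt_inv ℝ one_ne_zero).neg
  norm_num at this
  refine this.congr ?_
  filter_upwards [eventually_punctured_one] with s hs
  have h := Gamma_sub_ne_zero hs.1 hs.2.1 hs.2.2 0
  have e := Real.Gamma_add_one (s := -s) (by linarith [hs.1])
  rw [show (1 : ℝ) - s = -s + 1 by ring, e]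
  have hs0 := hs.1.ne'
  simp at h ⊢
  field_simp

/-- The functional equation makes the ratio `-1/s` for `m = 0` and a polynomial for `m ≥ 1`. -/
lemma exists_hasSmoothExt_Gamma_ratio (m : ℕ) :
    ∃ c, HasSmoothExt (fun s => Real.Gamma (m - s) / Real.Gamma (1 - s)) c := by
  induction m with
  | zero => exact ⟨_, hasSmoothExt_Gamma_ratio_zero⟩
  | succ m ih =>
    obtain rfl | hm := Nat.eq_zero_or_pos m
    · refine ⟨_, (HasSmoothExt.of_contDiffAt (f := fun _ => (1 : ℝ)) contDiffAt_const).congr ?_⟩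
      filter_upwards [eventually_punctured_one] with s hs
      have h := Gamma_sub_ne_zero hs.1 hs.2.1 hs.2.2 1
      simpa using div_self h
    · obtain ⟨c, hc⟩ := ih
      refine ⟨_, ((HasSmoothExt.of_contDiffAt (f := fun s : ℝ => m - s)
        (contDiffAt_const.sub contDiffAt_id)).mul hc).congr ?_⟩
      filter_upwards [eventually_punctured_one] with s hs
      have hne : (m : ℝ) - s ≠ 0 := by
        intro h
        have e : s = m := by linarith
        have h2 : m < 2 := by exact_mod_cast e ▸ hs.2.1
        have : m = 1 := by omega
        exact hs.2.2 (by rw [e, this]; simp)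
      have := Real.Gamma_add_one hne
      rw [show ((m + 1 : ℕ) : ℝ) - s = m - s + 1 by push_cast; ring, this]
      ring

/-! ### The function `η` at its removable singularity -/

section

variable {M : ℕ}

lemma lam_mono (ℓ : Fin M → ℕ) : Monotone (lam ℓ) := fun a b hab => by
  refine Finset.sum_le_sum_of_subset fun k => ?_
  simp only [Finset.mem_filter, Finset.mem_univ, true_and]
  omega

lemma abs_hoyt_arg_lt_one {x : ℝ} (hx : 0 < x) : |((1 - x ^ 2) / (1 + x ^ 2)) ^ 2| < 1 := by
  rw [abs_of_nonneg (sq_nonneg _), sq_lt_one_iff_abs_lt_one, abs_div, abs_of_pos (by positivity :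
    0 < 1 + x ^ 2), div_lt_one (by positivity), abs_lt]
  constructor <;> nlinarith [sq_pos_of_pos hx]

/-- The factor `(s - 1) ^ r` cancels exactly the poles of `Γ(1 + λ_{n-1} - s)`, `n ≤ r`. -/
lemma eta_eq {q : Fin (M + 1) → ℝ} {ℓ : Fin M → ℕ} {r : ℕ} (hr : r ≤ M + 1) (s : ℝ) :
    eta q ℓ r s = Real.Gamma (lam ℓ M - s) / Real.Gamma (1 - s) *
      ∏ n : Fin (M + 1), (if n.val < r then s - 1 else 1) * Real.Gamma (1 + lam ℓ n - s) *
        ₂F₁ ((1 + lam ℓ n - s) / 2) ((2 + lam ℓ n - s) / 2) (1 : ℝ)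
          (((1 - q n ^ 2) / (1 + q n ^ 2)) ^ 2) := by
  have h : ∏ n : Fin (M + 1), (if n.val < r then s - 1 else 1) = (s - 1) ^ r := by
    rw [Finset.prod_ite, Finset.prod_const, Finset.prod_const_one, mul_one]
    congr 1
    rw [Fin.card_filter_val_lt]
    omega
  simp only [mul_assoc, Finset.prod_mul_distrib, h, eta]
  ring

lemma hasSmoothExt_eta {q : Fin (M + 1) → ℝ} (hq : ∀ n, 0 < q n) {ℓ : Fin M → ℕ} {r : ℕ}
    (hr : r ≤ M + 1) (h0 : ∀ n < r, lam ℓ n = 0) (h1 : ∀ n ≤ M, r ≤ n → 0 < lam ℓ n) {c : ℝ}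
    (hc : HasSmoothExt (fun s => Real.Gamma (lam ℓ M - s) / Real.Gamma (1 - s)) c) :
    HasSmoothExt (eta q ℓ r) (c * ∏ n : Fin (M + 1),
      (if n.val < r then -1 else Real.Gamma (lam ℓ n)) *
        ₂F₁ ((1 + lam ℓ n - 1 : ℝ) / 2) ((2 + lam ℓ n - 1) / 2) (1 : ℝ)
          (((1 - q n ^ 2) / (1 + q n ^ 2)) ^ 2)) := by
  refine HasSmoothExt.congr (hc.mul (HasSmoothExt.prod Finset.univ fun n _ =>
    (hasSmoothExt_Gamma_mul (lam ℓ n) r n (h0 n) (h1 n (Nat.lt_succ_iff.1 n.2))).mul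
      (HasSmoothExt.of_contDiffAt (contDiffAt_hypergeometric (lam ℓ n)
        (abs_hoyt_arg_lt_one (hq n))))))
    (Eventually.of_forall fun s => eta_eq hr s)

lemma exists_hasSmoothExt_eta {q : Fin (M + 1) → ℝ} (hq : ∀ n, 0 < q n) {L ℓ : Fin M → ℕ} {r : ℕ}
    (hr : r ∈ Finset.Icc 1 (M + 1)) (hℓ : ℓ ∈ indexSet L r) : ∃ c, HasSmoothExt (eta q ℓ r) c := by
  rw [Finset.mem_Icc] at hr
  obtain ⟨-, h0, h1⟩ := Finset.mem_filter.1 hℓ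
  obtain ⟨c, hc⟩ := exists_hasSmoothExt_Gamma_ratio (lam ℓ M)
  refine ⟨_, hasSmoothExt_eta hq hr.2 (fun n hn => ?_) (fun n hn hrn => ?_) hc⟩
  · exact Nat.eq_zero_of_le_zero (h0 ▸ lam_mono ℓ (by omega))
  · exact (h1 (by omega)).trans_le (lam_mono ℓ hrn)

lemma tendsto_iteratedDeriv_eta {q : Fin (M + 1) → ℝ} (hq : ∀ n, 0 < q n) {L ℓ : Fin M → ℕ} {r : ℕ}
    (hr : r ∈ Finset.Icc 1 (M + 1)) (hℓ : ℓ ∈ indexSet L r) (k : ℕ) :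
    Tendsto (iteratedDeriv k (eta q ℓ r)) (𝓝[≠] (1 : ℝ)) (𝓝 (etaDeriv q ℓ r k)) := by
  obtain ⟨c, hc⟩ := exists_hasSmoothExt_eta hq hr hℓ
  exact tendsto_nhds_limUnder (hc.exists_tendsto_iteratedDeriv k)

lemma lam_zero (n : ℕ) : lam (0 : Fin M → ℕ) n = 0 := by simp [lam]

/-- At `s = 1` each first hypergeometric parameter vanishes, so those factors are `1`. The Gamma
ratio and the `M + 1` cancelled poles each give `-1`. -/
lemma etaDeriv_zero {q : Fin (M + 1) → ℝ} (hq : ∀ n, 0 < q n) :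
    etaDeriv q 0 (M + 1) 0 = (-1) ^ M := by
  have h := hasSmoothExt_eta hq (ℓ := 0) le_rfl (fun n _ => lam_zero n)
    (fun n hn hn' => absurd hn' (by omega))
    (by rw [lam_zero]; exact hasSmoothExt_Gamma_ratio_zero)
  have hF (z : ℝ) : ₂F₁ (0 : ℝ) (1 / 2) (1 : ℝ) z = 1 := by
    rw [ordinaryHypergeometric_eq_tsum]
    refine (tsum_eq_single 0 fun k hk => ?_).trans (by simp)
    simp [hk]
  have h2 := h.tendsto
  have : (2 - 1 : ℝ) / 2 = 1 / 2 := by norm_num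
  simp only [lam_zero, Nat.cast_zero, add_zero, sub_self, zero_div, this, hF, Fin.is_lt, if_true,
    mul_one, Finset.prod_const, Finset.card_univ, Fintype.card_fin] at h2
  rw [etaDeriv, iteratedDeriv_zero, h2.limUnder_eq, pow_succ]
  ring

end

end SmoothExtension

/-! ### Lower tails of products of independent positive random variables -/

/-- An iterated limit: for fixed `ε` the bounds converge along `l` to `b ε` and `a ε`, and only then
`ε → 0`. -/
lemma tendsto_of_forall_squeeze {α : Type*} {l : Filter α} {f : α → ℝ} {a b : ℝ → ℝ} {c : ℝ}
    (ha : Tendsto a (𝓝[>] 0) (𝓝 c)) (hb : Tendsto b (𝓝[>] 0) (𝓝 c))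
    (h : ∀ᶠ ε in 𝓝[>] (0 : ℝ), ∃ U V : α → ℝ, Tendsto U l (𝓝 (b ε)) ∧ Tendsto V l (𝓝 (a ε)) ∧
      ∀ᶠ t in l, V t ≤ f t ∧ f t ≤ U t) : Tendsto f l (𝓝 c) := by
  refine tendsto_order.2 ⟨fun x hx => ?_, fun x hx => ?_⟩
  · obtain ⟨ε, hε, U, V, -, hV, hf⟩ := ((ha.eventually_const_lt hx).and h).exists
    filter_upwards [hf, hV.eventually_const_lt hε] with t h1 h2 using h2.trans_le h1.1
  · obtain ⟨ε, hε, U, V, hU, -, hf⟩ := ((hb.eventually_lt_const hx).and h).exists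
    filter_upwards [hf, hU.eventually_lt_const hε] with t h1 h2 using h1.2.trans_lt h2

lemma tendsto_neg_log_nhdsGT_zero : Tendsto (fun t => -Real.log t) (𝓝[>] 0) atTop :=
  tendsto_neg_atBot_atTop.comp Real.tendsto_log_nhdsGT_zero

lemma tendsto_log_div_div_neg_log {δ : ℝ} (hδ : 0 < δ) :
    Tendsto (fun t => Real.log (δ / t) / -Real.log t) (𝓝[>] 0) (𝓝 1) := by
  have h : Tendsto (fun t => Real.log δ / -Real.log t + 1) (𝓝[>] 0) (𝓝 (0 + 1)) :=
    (tendsto_neg_log_nhdsGT_zero.const_div_atTop _).add_const 1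
  rw [zero_add] at h
  refine h.congr' ?_
  filter_upwards [self_mem_nhdsWithin, tendsto_neg_log_nhdsGT_zero.eventually_gt_atTop 0]
    with t ht hl
  rw [Real.log_div hδ.ne' (ne_of_gt ht), sub_eq_add_neg, add_div, div_self hl.ne']

/-- `F t ∼ C t (log (1 / t)) ^ m` as `t → 0+`. -/
def LogTail (F : ℝ → ℝ) (m : ℕ) (C : ℝ) : Prop :=
  Tendsto (fun t => F t / (t * (-Real.log t) ^ m)) (𝓝[>] 0) (𝓝 C)

lemma LogTail.comp_const_mul {F : ℝ → ℝ} {m : ℕ} {C : ℝ} (h : LogTail F m C) {a : ℝ} (ha : 0 < a) :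
    LogTail (fun t => F (a * t)) m (a * C) := by
  have h1 : Tendsto (fun t : ℝ => a * t) (𝓝[>] 0) (𝓝[>] 0) := by
    refine tendsto_nhdsWithin_iff.2 ⟨?_, ?_⟩
    · have : Tendsto (fun t : ℝ => a * t) (𝓝 0) (𝓝 (a * 0)) := Continuous.tendsto (by fun_prop) 0
      rw [mul_zero] at this
      exact this.mono_left nhdsWithin_le_nhds
    · filter_upwards [self_mem_nhdsWithin] with t ht using mul_pos ha ht
  have h2 := ((h.comp h1).mul ((tendsto_log_div_div_neg_log (inv_pos.2 ha)).pow m)).const_mul a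
  rw [one_pow, mul_one] at h2
  refine Tendsto.congr' ?_ h2
  filter_upwards [self_mem_nhdsWithin, tendsto_neg_log_nhdsGT_zero.eventually_gt_atTop 0,
    h1.eventually (tendsto_neg_log_nhdsGT_zero.eventually_gt_atTop 0)] with t ht hl hl'
  have ht0 : t ≠ 0 := ne_of_gt ht
  have e : Real.log (a⁻¹ / t) = -Real.log (a * t) := by
    rw [← Real.log_inv]; congr 1; field_simp
  rw [e, Function.comp_apply, div_pow]
  have := (pow_pos hl m).ne'
  have := (pow_pos hl' m).ne'
  have := ha.ne'
  field_simp

/-- This is what discards the far part of a mixture and the partial products in the outage bound. -/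
lemma LogTail.lower_order {F : ℝ → ℝ} {m k : ℕ} {C : ℝ} (h : LogTail F m C) (hk : m < k) :
    LogTail F k 0 := by
  obtain ⟨j, rfl⟩ := Nat.exists_eq_add_of_lt hk
  have h2 := h.mul ((tendsto_inv_atTop_zero.comp tendsto_neg_log_nhdsGT_zero).pow (j + 1))
  rw [zero_pow (Nat.succ_ne_zero j), mul_zero] at h2
  refine Tendsto.congr' ?_ h2
  filter_upwards [self_mem_nhdsWithin, tendsto_neg_log_nhdsGT_zero.eventually_gt_atTop 0]
    with t ht hl
  have ht0 : t ≠ 0 := ne_of_gt ht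
  have := (pow_pos hl m).ne'
  have := (pow_pos hl (j + 1)).ne'
  simp only [Function.comp_apply, inv_pow]
  rw [add_assoc, pow_add _ m, ← mul_assoc, div_mul_eq_div_div _ _ ((-Real.log t) ^ (j + 1)),
    div_eq_mul_inv _ ((-Real.log t) ^ (j + 1))]

lemma integral_div_mul_log_pow {t K δ : ℝ} (ht : 0 < t) (hK : 0 < K) (h : t * K ≤ δ) (m : ℕ) :
    ∫ x in (t * K)..δ, t / x * Real.log (x / t) ^ m =
      t * (Real.log (δ / t) ^ (m + 1) - Real.log K ^ (m + 1)) / (m + 1) := by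
  have hpos : ∀ x ∈ Set.uIcc (t * K) δ, 0 < x := fun x hx => by
    rw [Set.uIcc_of_le h] at hx
    exact (mul_pos ht hK).trans_le hx.1
  have hd : ∀ x ∈ Set.uIcc (t * K) δ,
      HasDerivAt (fun x => t * Real.log (x / t) ^ (m + 1) / (m + 1))
        (t / x * Real.log (x / t) ^ m) x := fun x hx => by
    have hx := (hpos x hx).ne'
    have hl : HasDerivAt (fun x => Real.log (x / t)) x⁻¹ x := by
      refine (((hasDerivAt_id x).div_const t).log (div_ne_zero hx ht.ne')).congr_deriv ?_
      rw [id_eq]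
      field_simp
    refine (((hl.fun_pow (m + 1)).const_mul t).div_const ((m : ℝ) + 1)).congr_deriv ?_
    have : (m : ℝ) + 1 ≠ 0 := by positivity
    push_cast
    field_simp
  rw [intervalIntegral.integral_eq_sub_of_hasDerivAt hd]
  · rw [mul_div_cancel_left₀ _ ht.ne']; ring
  · refine ContinuousOn.intervalIntegrable fun x hx => ContinuousAt.continuousWithinAt ?_
    have hx := (hpos x hx).ne'
    have : x / t ≠ 0 := div_ne_zero hx ht.ne'
    exact (continuousAt_const.div continuousAt_id hx).mul
      (((continuousAt_id.div_const t).log this).pow m)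

/-- `t * K` will bound the integral over `(0, tK)`, and the remaining term is the model integral
over `(tK, δ)`; the cutoff `K` disappears in the limit. -/
lemma tendsto_integral_majorant (K D δ : ℝ) (hδ : 0 < δ) (m : ℕ) :
    Tendsto (fun t => (t * K + D * (t * (Real.log (δ / t) ^ (m + 1) - Real.log K ^ (m + 1)) /
      (m + 1))) / (t * (-Real.log t) ^ (m + 1))) (𝓝[>] 0) (𝓝 (D / (m + 1))) := by
  have h0 := (tendsto_inv_atTop_zero.comp tendsto_neg_log_nhdsGT_zero).pow (m + 1)
  have h1 := (tendsto_log_div_div_neg_log hδ).pow (m + 1)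
  have := ((h1.const_mul (D / (m + 1))).add
    (h0.const_mul (K - D * Real.log K ^ (m + 1) / (m + 1))))
  rw [zero_pow (Nat.succ_ne_zero m), one_pow, mul_one, mul_zero, add_zero] at this
  refine this.congr' ?_
  filter_upwards [self_mem_nhdsWithin, tendsto_neg_log_nhdsGT_zero.eventually_gt_atTop 0]
    with t ht hl
  have ht0 : t ≠ 0 := ne_of_gt ht
  have := (pow_pos hl (m + 1)).ne'
  have : (m : ℝ) + 1 ≠ 0 := by positivity
  simp only [Function.comp_apply, inv_pow, div_pow]
  field_simp
  ring

/-! ### Mixing a logarithmic tail with a power density -/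

section Integrals

variable {F : ℝ → ℝ}

lemma intervalIntegrable_comp_div (hF : Monotone F) (h0 : ∀ x, 0 ≤ F x) (h1 : ∀ x, F x ≤ 1)
    (t a b : ℝ) : IntervalIntegrable (fun x => F (t / x)) volume a b := by
  refine (intervalIntegrable_const (c := (1 : ℝ))).mono_fun'
    (hF.measurable.comp (measurable_const.div measurable_id)).aestronglyMeasurable
    (Eventually.of_forall fun x => ?_)
  simpa [abs_of_nonneg (h0 _)] using h1 (t / x)

lemma LogTail.integral_comp_div {m : ℕ} {C : ℝ} (hF : Monotone F) (h0 : ∀ x, 0 ≤ F x)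
    (h1 : ∀ x, F x ≤ 1) (h : LogTail F m C) {δ : ℝ} (hδ : 0 < δ) :
    LogTail (fun t => ∫ x in (0 : ℝ)..δ, F (t / x)) (m + 1) (C / (m + 1)) := by
  have hε (s : ℝ) : Tendsto (fun ε : ℝ => (C + s * ε) / (m + 1)) (𝓝[>] 0) (𝓝 (C / (m + 1))) := by
    have : Tendsto (fun ε : ℝ => (C + s * ε) / (m + 1)) (𝓝 0) (𝓝 ((C + s * 0) / (m + 1))) :=
      Continuous.tendsto (by fun_prop) 0
    rw [mul_zero, add_zero] at this
    exact this.mono_left nhdsWithin_le_nhds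
  refine tendsto_of_forall_squeeze (hε (-1)) (hε 1) ?_
  filter_upwards [self_mem_nhdsWithin] with ε hε
  have hev : ∀ᶠ t in 𝓝[>] (0 : ℝ), (C - ε) * (t * (-Real.log t) ^ m) ≤ F t ∧
      F t ≤ (C + ε) * (t * (-Real.log t) ^ m) := by
    filter_upwards [h.eventually_const_lt (sub_lt_self C hε),
      h.eventually_lt_const (lt_add_of_pos_right C hε), self_mem_nhdsWithin,
      tendsto_neg_log_nhdsGT_zero.eventually_gt_atTop 0] with t h1 h2 ht hl
    have hp : 0 < t * (-Real.log t) ^ m := mul_pos ht (pow_pos hl m)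
    exact ⟨((lt_div_iff₀ hp).1 h1).le, ((div_lt_iff₀ hp).1 h2).le⟩
  -- The tail estimate for `F (t / x)` holds when `t / x ≤ u`, i.e. `x ≥ t * u⁻¹`; this fixes the
  -- cutoff `K = u⁻¹`. Below it only `0 ≤ F ≤ 1` is used.
  obtain ⟨u, hu, hFu⟩ := mem_nhdsGT_iff_exists_Ioc_subset.1 hev
  replace hu : 0 < u := hu
  have hKpos : 0 < u⁻¹ := inv_pos.2 hu
  refine ⟨_, fun t => ((C + -1 * ε) * (t * (Real.log (δ / t) ^ (m + 1) - Real.log u⁻¹ ^ (m + 1)) /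
      (m + 1))) / (t * (-Real.log t) ^ (m + 1)),
    tendsto_integral_majorant u⁻¹ (C + 1 * ε) δ hδ m, ?_, ?_⟩
  · have h2 := (tendsto_integral_majorant u⁻¹ (C + -1 * ε) δ hδ m).sub
      (((tendsto_inv_atTop_zero.comp tendsto_neg_log_nhdsGT_zero).pow (m + 1)).const_mul u⁻¹)
    rw [zero_pow (Nat.succ_ne_zero m), mul_zero, sub_zero] at h2
    refine h2.congr' ?_
    filter_upwards [self_mem_nhdsWithin, tendsto_neg_log_nhdsGT_zero.eventually_gt_atTop 0]
      with t ht hl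
    have ht0 : t ≠ 0 := ne_of_gt ht
    have := hl.ne'
    simp only [Function.comp_apply, inv_pow]
    field_simp
    ring
  have hδu : ∀ᶠ t in 𝓝[>] (0 : ℝ), t < δ * u :=
    mem_nhdsWithin_of_mem_nhds (Iio_mem_nhds (mul_pos hδ hu))
  filter_upwards [self_mem_nhdsWithin, hδu,
    tendsto_neg_log_nhdsGT_zero.eventually_gt_atTop 0] with t ht htδ hl
  replace ht : 0 < t := ht
  have hle : t * u⁻¹ ≤ δ := by rw [← div_eq_mul_inv, div_le_iff₀ hu]; exact htδ.le
  have hp : 0 < t * (-Real.log t) ^ (m + 1) := mul_pos ht (pow_pos hl _)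
  have hI := intervalIntegrable_comp_div hF h0 h1 t
  have hmain : ∀ x ∈ Set.Icc (t * u⁻¹) δ,
      (C - ε) * (t / x * Real.log (x / t) ^ m) ≤ F (t / x) ∧
        F (t / x) ≤ (C + ε) * (t / x * Real.log (x / t) ^ m) := fun x hx => by
    have hx0 : 0 < x := (mul_pos ht hKpos).trans_le hx.1
    have : t / x ∈ Set.Ioc 0 u := by
      refine ⟨div_pos ht hx0, ?_⟩
      have := hx.1
      rw [← div_eq_mul_inv, div_le_iff₀ hu] at this
      rw [div_le_iff₀ hx0]; linarith only [this]
    have h := hFu this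
    rw [Set.mem_ofPred_eq, ← Real.log_inv, inv_div] at h
    exact h
  have hJ (c : ℝ) : IntervalIntegrable (fun x => c * (t / x * Real.log (x / t) ^ m)) volume
      (t * u⁻¹) δ := by
    refine IntervalIntegrable.const_mul (ContinuousOn.intervalIntegrable fun x hx =>
      ContinuousAt.continuousWithinAt ?_) c
    rw [Set.uIcc_of_le hle] at hx
    have hx0 := ((mul_pos ht hKpos).trans_le hx.1).ne'
    have : x / t ≠ 0 := div_ne_zero hx0 ht.ne'
    exact (continuousAt_const.div continuousAt_id hx0).mul
      (((continuousAt_id.div_const t).log this).pow m)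
  have hup := intervalIntegral.integral_mono_on hle (hI _ _) (hJ (C + ε)) fun x hx => (hmain x hx).2
  have hlo := intervalIntegral.integral_mono_on hle (hJ (C - ε)) (hI _ _) fun x hx => (hmain x hx).1
  rw [intervalIntegral.integral_const_mul, integral_div_mul_log_pow ht hKpos hle] at hup hlo
  have htu : 0 ≤ t * u⁻¹ := (mul_pos ht hKpos).le
  have hsplit := intervalIntegral.integral_add_adjacent_intervals (hI 0 (t * u⁻¹)) (hI (t * u⁻¹) δ)
  have hn : 0 ≤ ∫ x in (0 : ℝ)..(t * u⁻¹), F (t / x) :=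
    intervalIntegral.integral_nonneg htu fun x _ => h0 _
  have hs : ∫ x in (0 : ℝ)..(t * u⁻¹), F (t / x) ≤ t * u⁻¹ := by
    have := intervalIntegral.integral_mono_on htu (hI _ _)
      (intervalIntegrable_const (c := (1 : ℝ))) fun x _ => h1 (t / x)
    simpa using this
  rw [neg_one_mul, one_mul, ← sub_eq_add_neg]
  constructor
  · gcongr
    linarith only [hsplit, hlo, hn]
  · gcongr
    linarith only [hsplit, hup, hs]

/-- A probability density on the half line with right limit `c` at the origin. -/
structure IsPowerDensity (f : ℝ → ℝ) (c : ℝ) : Prop where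
  measurable : Measurable f
  nonneg : ∀ x, 0 ≤ f x
  eq_zero : ∀ x < 0, f x = 0
  tendsto : Tendsto f (𝓝[>] 0) (𝓝 c)
  integrable : Integrable f
  integral_eq_one : ∫ x, f x = 1

/-- On `(0, δ]` the density is replaced by its bounds; beyond `δ`, monotonicity gives `F (t / x) ≤ F
(t / δ)` and the total mass is `1`. -/
lemma IsPowerDensity.mixture_bounds {f : ℝ → ℝ} {c : ℝ} (hf : IsPowerDensity f c) (hF : Monotone F)
    (h0 : ∀ x, 0 ≤ F x) (h1 : ∀ x, F x ≤ 1) {a b δ t : ℝ} (hδ : 0 < δ) (ht : 0 < t)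
    (hab : ∀ x ∈ Set.Ioc 0 δ, a ≤ f x ∧ f x ≤ b) :
    a * (∫ x in (0 : ℝ)..δ, F (t / x)) ≤ ∫ x, f x * F (t / x) ∧
      ∫ x, f x * F (t / x) ≤ b * (∫ x in (0 : ℝ)..δ, F (t / x)) + F (t / δ) := by
  have hint : Integrable fun x => f x * F (t / x) := by
    refine hf.integrable.mono' (hf.measurable.mul
      (hF.measurable.comp (measurable_const.div measurable_id))).aestronglyMeasurable
      (Eventually.of_forall fun x => ?_)
    rw [Real.norm_of_nonneg (mul_nonneg (hf.nonneg x) (h0 _))]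
    exact mul_le_of_le_one_right (hf.nonneg x) (h1 _)
  have hI := (intervalIntegrable_iff_integrableOn_Ioc_of_le hδ.le).1
    (intervalIntegrable_comp_div hF h0 h1 t 0 δ)
  rw [← integral_add_compl measurableSet_Ioc hint, intervalIntegral.integral_of_le hδ.le,
    ← integral_const_mul a, ← integral_const_mul b]
  have hlo := setIntegral_mono_on (hI.const_mul a) hint.integrableOn measurableSet_Ioc
    fun x hx => mul_le_mul_of_nonneg_right (hab x hx).1 (h0 (t / x))
  have hup := setIntegral_mono_on hint.integrableOn (hI.const_mul b) measurableSet_Ioc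
    fun x hx => mul_le_mul_of_nonneg_right (hab x hx).2 (h0 (t / x))
  have hn : 0 ≤ ∫ x in (Set.Ioc 0 δ)ᶜ, f x * F (t / x) :=
    integral_nonneg fun x => mul_nonneg (hf.nonneg x) (h0 _)
  have htail : ∫ x in (Set.Ioc 0 δ)ᶜ, f x * F (t / x) ≤ F (t / δ) := by
    have h2 := setIntegral_mono_on hint.integrableOn
      (hf.integrable.mul_const (F (t / δ))).integrableOn (measurableSet_Ioc.compl :
        MeasurableSet (Set.Ioc 0 δ)ᶜ) fun x hx => ?_
    · refine h2.trans ?_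
      have h3 : ∫ x in (Set.Ioc 0 δ)ᶜ, f x * F (t / δ) ≤ ∫ x, f x * F (t / δ) :=
        setIntegral_le_integral (hf.integrable.mul_const _)
          (Eventually.of_forall fun x => mul_nonneg (hf.nonneg x) (h0 _))
      rwa [integral_mul_const (F (t / δ)) f (μ := volume), hf.integral_eq_one, one_mul] at h3
    · rcases lt_trichotomy x 0 with hx0 | rfl | hx0
      · simp [hf.eq_zero x hx0]
      -- The point `x = 0` lies in the complement; there `t / 0 = 0 ≤ t / δ`.
      · exact mul_le_mul_of_nonneg_left (hF (by simpa using (div_pos ht hδ).le)) (hf.nonneg _)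
      · have : δ < x := by
          by_contra hc
          exact hx ⟨hx0, not_lt.1 hc⟩
        exact mul_le_mul_of_nonneg_left
          (hF (div_le_div_of_nonneg_left ht.le hδ this.le)) (hf.nonneg _)
  exact ⟨hlo.trans (le_add_of_nonneg_right hn), add_le_add hup htail⟩

lemma IsPowerDensity.exists_bounds {f : ℝ → ℝ} {c : ℝ} (hf : IsPowerDensity f c) {ε : ℝ}
    (hε : 0 < ε) : ∃ δ > 0, ∀ x ∈ Set.Ioc 0 δ, c - ε ≤ f x ∧ f x ≤ c + ε := by
  have hev : ∀ᶠ x in 𝓝[>] (0 : ℝ), c - ε ≤ f x ∧ f x ≤ c + ε := by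
    filter_upwards [hf.tendsto.eventually_const_lt (sub_lt_self c hε),
      hf.tendsto.eventually_lt_const (lt_add_of_pos_right c hε)] with x h1 h2 using ⟨h1.le, h2.le⟩
  obtain ⟨u, hu, hFu⟩ := mem_nhdsGT_iff_exists_Ioc_subset.1 hev
  exact ⟨u, hu, hFu⟩

lemma IsPowerDensity.logTail_mixture {f : ℝ → ℝ} {c C : ℝ} {m : ℕ} (hf : IsPowerDensity f c)
    (hF : Monotone F) (h0 : ∀ x, 0 ≤ F x) (h1 : ∀ x, F x ≤ 1) (h : LogTail F m C) :
    LogTail (fun t => ∫ x, f x * F (t / x)) (m + 1) (c * (C / (m + 1))) := by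
  have hε (s : ℝ) : Tendsto (fun ε : ℝ => (c + s * ε) * (C / (m + 1))) (𝓝[>] 0)
      (𝓝 (c * (C / (m + 1)))) := by
    have : Tendsto (fun ε : ℝ => (c + s * ε) * (C / (m + 1))) (𝓝 0)
      (𝓝 ((c + s * 0) * (C / (m + 1)))) := Continuous.tendsto (by fun_prop) 0
    rw [mul_zero, add_zero] at this
    exact this.mono_left nhdsWithin_le_nhds
  refine tendsto_of_forall_squeeze (hε (-1)) (hε 1) ?_
  filter_upwards [self_mem_nhdsWithin] with ε hε
  obtain ⟨δ, hδ, hb⟩ := hf.exists_bounds hε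
  have hI := h.integral_comp_div hF h0 h1 hδ
  have hT := (h.comp_const_mul (inv_pos.2 hδ)).lower_order (Nat.lt_succ_self m)
  refine ⟨_, _, (hI.const_mul (c + 1 * ε)).add hT |>.trans (by rw [add_zero]),
    hI.const_mul (c + -1 * ε), ?_⟩
  filter_upwards [self_mem_nhdsWithin,
    tendsto_neg_log_nhdsGT_zero.eventually_gt_atTop 0] with t ht hl
  have hp : 0 < t * (-Real.log t) ^ (m + 1) := mul_pos ht (pow_pos hl _)
  obtain ⟨hlo, hup⟩ := hf.mixture_bounds hF h0 h1 hδ ht hb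
  rw [← mul_div_assoc, ← mul_div_assoc, ← add_div, neg_one_mul, one_mul, ← sub_eq_add_neg,
    inv_mul_eq_div]
  constructor <;> gcongr

lemma IsPowerDensity.logTail_cdf {f : ℝ → ℝ} {c : ℝ} (hf : IsPowerDensity f c) :
    LogTail (fun t => ∫ x in Set.Iio t, f x) 0 c := by
  have hε (s : ℝ) : Tendsto (fun ε : ℝ => c + s * ε) (𝓝[>] 0) (𝓝 c) := by
    have : Tendsto (fun ε : ℝ => c + s * ε) (𝓝 0) (𝓝 (c + s * 0)) :=
      Continuous.tendsto (by fun_prop) 0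
    rw [mul_zero, add_zero] at this
    exact this.mono_left nhdsWithin_le_nhds
  refine tendsto_of_forall_squeeze (hε (-1)) (hε 1) ?_
  filter_upwards [self_mem_nhdsWithin] with ε hε
  obtain ⟨δ, hδ, hb⟩ := hf.exists_bounds hε
  refine ⟨_, _, tendsto_const_nhds, tendsto_const_nhds, ?_⟩
  filter_upwards [self_mem_nhdsWithin, mem_nhdsWithin_of_mem_nhds (Iio_mem_nhds hδ)] with t ht htδ
  replace ht : 0 < t := ht
  have e : ∫ x in Set.Iio t, f x = ∫ x in Set.Ioc 0 t, f x := by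
    rw [← integral_Iic_eq_integral_Iio]
    refine (setIntegral_eq_of_subset_of_ae_sdiff_eq_zero measurableSet_Iic.nullMeasurableSet
      (fun x hx => hx.2) ?_)
    filter_upwards [Measure.ae_ne volume (0 : ℝ)] with x hx0 hx
    refine hf.eq_zero x (lt_of_le_of_ne (not_lt.1 fun h => hx.2 ⟨h, hx.1⟩) hx0)
  have hi (a : ℝ) : IntegrableOn (fun _ : ℝ => a) (Set.Ioc 0 t) := integrableOn_const (by simp)
  have hlo := setIntegral_mono_on (hi (c - ε)) hf.integrable.integrableOn measurableSet_Ioc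
    fun x hx => (hb x ⟨hx.1, hx.2.trans htδ.le⟩).1
  have hup := setIntegral_mono_on hf.integrable.integrableOn (hi (c + ε)) measurableSet_Ioc
    fun x hx => (hb x ⟨hx.1, hx.2.trans htδ.le⟩).2
  simp only [setIntegral_const, smul_eq_mul, Real.volume_real_Ioc_of_le ht.le, sub_zero]
    at hlo hup
  rw [e, pow_zero, mul_one, le_div_iff₀ ht, div_le_iff₀ ht]
  exact ⟨by linear_combination hlo, by linear_combination hup⟩

end Integrals

lemma ae_pos_of_hasLaw {Ω : Type*} [MeasurableSpace Ω] {P : Measure Ω} {X : Ω → ℝ} {f : ℝ → ℝ}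
    {c : ℝ} (hf : IsPowerDensity f c)
    (hX : HasLaw X (volume.withDensity fun x => ENNReal.ofReal (f x)) P) : ∀ᵐ ω ∂P, 0 < X ω := by
  have h : P {ω | X ω ≤ 0} = 0 := by
    rw [hX.measure_eq (p := fun x => x ≤ 0) measurableSet_Iic, withDensity_apply]
    · refine (setLIntegral_congr (Iio_ae_eq_Iic (μ := volume) (a := (0 : ℝ))).symm).trans ?_
      refine (setLIntegral_congr_fun measurableSet_Iio fun x hx => ?_).trans (lintegral_zero)
      simp [hf.eq_zero x hx]
    · exact measurableSet_Iic
  rw [ae_iff]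
  simpa using h

lemma measureReal_lt {Ω : Type*} [MeasurableSpace Ω] {P : Measure Ω} {X : Ω → ℝ} {f : ℝ → ℝ}
    {c : ℝ} (hf : IsPowerDensity f c)
    (hX : HasLaw X (volume.withDensity fun x => ENNReal.ofReal (f x)) P) (t : ℝ) :
    P.real {ω | X ω < t} = ∫ x in Set.Iio t, f x := by
  rw [Measure.real, hX.measure_eq (p := fun x => x < t) measurableSet_Iio,
    show {x | x < t} = Set.Iio t from rfl, withDensity_apply _ measurableSet_Iio, ← integral_toReal
      hf.measurable.ennreal_ofReal.aemeasurable
      (Eventually.of_forall fun _ => ENNReal.ofReal_lt_top)]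
  exact integral_congr_ae (Eventually.of_forall fun x => ENNReal.toReal_ofReal (hf.nonneg x))

/-! ### Products of independent powers -/

section Products

variable {Ω : Type*} [MeasurableSpace Ω] {P : Measure Ω} [IsProbabilityMeasure P]

/-- Fubini for the product law. The division by `x` is legitimate because the density vanishes for
`x < 0` and `x = 0` is a null set. -/
lemma measureReal_mul_lt {X Y : Ω → ℝ} {f : ℝ → ℝ} {c : ℝ} (hf : IsPowerDensity f c)
    (hX : HasLaw X (volume.withDensity fun x => ENNReal.ofReal (f x)) P) (hY : AEMeasurable Y P)
    (hXY : IndepFun X Y P) (t : ℝ) :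
    P.real {ω | X ω * Y ω < t} = ∫ x, f x * P.real {ω | Y ω < t / x} := by
  set μ : Measure ℝ := volume.withDensity fun x => ENNReal.ofReal (f x) with hμ
  have hν : IsProbabilityMeasure (P.map Y) := Measure.isProbabilityMeasure_map hY
  have hS : MeasurableSet {p : ℝ × ℝ | p.1 * p.2 < t} :=
    measurableSet_lt (measurable_fst.mul measurable_snd) measurable_const
  have h1 : P {ω | X ω * Y ω < t} =
      ∫⁻ x, (P.map Y) (Prod.mk x ⁻¹' {p : ℝ × ℝ | p.1 * p.2 < t}) ∂μ := by
    have := hXY.map_prod_eq_prod_map_map hX.aemeasurable hY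
    rw [hX.map_eq] at this
    rw [← Measure.prod_apply hS, ← this,
      Measure.map_apply_of_aemeasurable (hX.aemeasurable.prodMk hY) hS]
    rfl
  rw [Measure.real, h1, ← integral_toReal (measurable_measure_prodMk_left hS).aemeasurable
    (Eventually.of_forall fun _ => measure_lt_top _ _), hμ,
    integral_withDensity_eq_integral_toReal_smul hf.measurable.ennreal_ofReal
      (Eventually.of_forall fun _ => ENNReal.ofReal_lt_top)]
  refine integral_congr_ae ?_
  filter_upwards [Measure.ae_ne volume (0 : ℝ)] with x hx
  rw [ENNReal.toReal_ofReal (hf.nonneg x), smul_eq_mul]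
  rcases lt_or_gt_of_ne hx with h | h
  · simp [hf.eq_zero x h]
  · have : Prod.mk x ⁻¹' {p : ℝ × ℝ | p.1 * p.2 < t} = Set.Iio (t / x) := by
      ext y
      simp [lt_div_iff₀ h, mul_comm]
    rw [this, Measure.map_apply_of_aemeasurable hY measurableSet_Iio]
    rfl

/-- Each further factor contributes its `c i`, one logarithm and a division by the new log exponent;
these divisions build up `m!`. -/
theorem logTail_prod {ι : Type*} {X : ι → Ω → ℝ} {f : ι → ℝ → ℝ} {c : ι → ℝ}
    (hf : ∀ i, IsPowerDensity (f i) (c i))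
    (hX : ∀ i, HasLaw (X i) (volume.withDensity fun x => ENNReal.ofReal (f i x)) P)
    (hindep : iIndepFun X P) {s : Finset ι} (hs : s.Nonempty) :
    ∀ m, s.card = m + 1 → LogTail (fun t => P.real {ω | ∏ i ∈ s, X i ω < t}) m
      ((∏ i ∈ s, c i) / (m.factorial : ℝ)) := by
  induction hs using Finset.Nonempty.cons_induction with
  | singleton a =>
    intro m hm
    obtain rfl : m = 0 := by simpa using hm.symm
    simpa [measureReal_lt (hf a) (hX a)] using (hf a).logTail_cdf
  | cons a s ha hs ih =>
    intro m hm
    rw [Finset.card_cons, Nat.add_right_cancel_iff] at hm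
    obtain ⟨k, rfl⟩ : ∃ k, m = k + 1 := ⟨m - 1, by have := hs.card_pos; omega⟩
    have hmono : Monotone fun t => P.real {ω | ∏ i ∈ s, X i ω < t} := fun t u htu =>
      measureReal_mono fun ω (hω : _ < t) => hω.trans_le htu
    have h := (hf a).logTail_mixture hmono (fun _ => measureReal_nonneg)
      (fun _ => measureReal_le_one) (ih k hm)
    have hind : IndepFun (X a) (fun ω => ∏ i ∈ s, X i ω) P := by
      have := (hindep.indepFun_finsetProd_of_notMem₀ (fun i => (hX i).aemeasurable) ha).symm
      rwa [Finset.prod_fn] at this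
    have hme : AEMeasurable (fun ω => ∏ i ∈ s, X i ω) P :=
      Finset.aemeasurable_fun_prod s fun i _ => (hX i).aemeasurable
    simp only [Finset.prod_cons, measureReal_mul_lt (hf a) (hX a) hme hind]
    convert h using 1
    rw [Nat.factorial_succ]
    push_cast
    have : (k.factorial : ℝ) ≠ 0 := by positivity
    field_simp

end Products

/-! ### The Hoyt density -/

/-- Locally uniform convergence: dropping one of the two factorials leaves an exponential series as
majorant. -/
lemma continuous_besselI0 : Continuous besselI0 := by
  rw [continuous_iff_continuousAt]
  intro x
  have h : ContinuousOn besselI0 (Metric.ball 0 (|x| + 1)) := by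
    refine continuousOn_tsum (fun k => by fun_prop)
      (Real.summable_pow_div_factorial (((|x| + 1) / 2) ^ 2)) fun k y hy => ?_
    have hy' : |y| ≤ |x| + 1 := by simpa using (Metric.mem_ball.1 hy).le
    have hk : (1 : ℝ) ≤ k.factorial := by exact_mod_cast k.factorial_pos
    rw [norm_div, norm_pow, norm_pow, Real.norm_natCast, ← pow_mul, Real.norm_eq_abs, abs_div,
      abs_two]
    gcongr
    nlinarith
  exact h.continuousAt (Metric.isOpen_ball.mem_nhds (by simp [Metric.mem_ball]))

lemma besselI0_zero : besselI0 0 = 1 := by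
  refine (tsum_eq_single 0 fun k hk => ?_).trans (by simp)
  simp [hk]

lemma besselI0_nonneg (x : ℝ) : 0 ≤ besselI0 x :=
  tsum_nonneg fun k => div_nonneg (by rw [pow_mul]; positivity) (by positivity)

/-- The total mass is not computed but read off from the instance, which the assumed hop laws
provide. -/
lemma isPowerDensity_hoytPDF {q θ : ℝ} (hq : 0 < q) (hθ : 0 < θ)
    [IsProbabilityMeasure (hoytMeasure q θ)] :
    IsPowerDensity (hoytPDF q θ) ((1 + q ^ 2) / (2 * q * θ)) := by
  have hcont : Continuous fun x => (1 + q ^ 2) / (2 * q * θ) *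
      Real.exp (-((1 + q ^ 2) ^ 2 / (4 * q ^ 2 * θ) * x)) *
      besselI0 ((1 - q ^ 4) / (4 * q ^ 2 * θ) * x) := by
    have := continuous_besselI0
    fun_prop
  have hmeas : Measurable (hoytPDF q θ) :=
    Measurable.ite measurableSet_Ici hcont.measurable measurable_const
  have hnonneg (x : ℝ) : 0 ≤ hoytPDF q θ x := by
    unfold hoytPDF
    split_ifs
    · exact mul_nonneg (by positivity) (besselI0_nonneg _)
    · exact le_rfl
  have hlint : ∫⁻ x, ENNReal.ofReal (hoytPDF q θ x) = 1 := by
    have := measure_univ (μ := hoytMeasure q θ)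
    rwa [hoytMeasure, withDensity_apply _ MeasurableSet.univ, setLIntegral_univ] at this
  refine ⟨hmeas, hnonneg, fun x hx => if_neg (not_le.2 hx), ?_, ⟨hmeas.aestronglyMeasurable, ?_⟩,
    ?_⟩
  · have h := (hcont.tendsto 0).mono_left (nhdsWithin_le_nhds (s := Set.Ioi 0))
    simp only [mul_zero, neg_zero, Real.exp_zero, besselI0_zero, mul_one] at h
    refine h.congr' ?_
    filter_upwards [self_mem_nhdsWithin] with x hx
    exact (if_pos (le_of_lt hx)).symm
  · rw [hasFiniteIntegral_iff_ofReal (Eventually.of_forall hnonneg), hlint]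
    exact ENNReal.one_lt_top
  · rw [integral_eq_lintegral_of_nonneg_ae (Eventually.of_forall hnonneg)
      hmeas.aestronglyMeasurable, hlint, ENNReal.toReal_one]

/-! ### The outage event -/

section Outage

variable {M : ℕ}

/-- The last summand of the denominator has an empty product, so the denominator is at least `ρ
(Fin.last M)`. -/
lemma prod_lt_of_prod_lt {x ρ : Fin (M + 1) → ℝ} (hx : ∀ n, 0 < x n) (hρ : ∀ n, 0 < ρ n)
    {γ γth : ℝ} (hγ : 0 < γ) (hγth : 0 < γth) (h : ∏ n, x n < ρ (Fin.last M) * (γth / γ)) :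
    (∏ n, x n) / (∑ n, ρ n * ∏ j ∈ Finset.Ioi n, x j) * γ < γth := by
  have hterm (n) : 0 < ρ n * ∏ j ∈ Finset.Ioi n, x j :=
    mul_pos (hρ n) (Finset.prod_pos fun j _ => hx j)
  have hD : ρ (Fin.last M) ≤ ∑ n, ρ n * ∏ j ∈ Finset.Ioi n, x j := by
    have := Finset.single_le_sum (f := fun n => ρ n * ∏ j ∈ Finset.Ioi n, x j)
      (fun n _ => (hterm n).le) (Finset.mem_univ (Fin.last M))
    have he : Finset.Ioi (Fin.last M) = ∅ := by
      ext j; simpa using Fin.le_last j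
    simpa [he] using this
  have hD0 := (hρ (Fin.last M)).trans_le hD
  rw [div_mul_eq_mul_div, div_lt_iff₀ hD0]
  rw [← mul_div_assoc, lt_div_iff₀ hγ] at h
  exact h.trans_le (by rw [mul_comm]; gcongr)

/-- If every alternative fails, then after scaling by `γth / γ` the last summand is at most the
fraction `1 - ε` of the full product and each of the other `M` at most `ε / M` of it. Summing
contradicts the outage. -/
lemma exists_prod_lt_of_snr_lt {x ρ : Fin (M + 1) → ℝ} (hx : ∀ n, 0 < x n) (hρ : ∀ n, 0 < ρ n)
    {γ γth ε : ℝ} (hγ : 0 < γ) (hγth : 0 < γth) (hM : 1 ≤ M) (hε : 0 < ε) (hε1 : ε < 1)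
    (h : (∏ n, x n) / (∑ n, ρ n * ∏ j ∈ Finset.Ioi n, x j) * γ < γth) :
    ∏ n, x n < ρ (Fin.last M) / (1 - ε) * (γth / γ) ∨
      ∃ k : Fin M, ∏ j ∈ Finset.Iic k.castSucc, x j < ρ k.castSucc * M / ε * (γth / γ) := by
  by_contra! hc
  obtain ⟨h1, h2⟩ := hc
  have hterm (n) : 0 < ρ n * ∏ j ∈ Finset.Ioi n, x j :=
    mul_pos (hρ n) (Finset.prod_pos fun j _ => hx j)
  have hD0 : 0 < ∑ n, ρ n * ∏ j ∈ Finset.Ioi n, x j :=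
    Finset.sum_pos (fun n _ => hterm n) ⟨0, Finset.mem_univ _⟩
  have hM0 : (0 : ℝ) < M := by exact_mod_cast hM
  set Y := ∏ n, x n with hY
  have hYpos : 0 < Y := Finset.prod_pos fun j _ => hx j
  have hk (k : Fin M) : γth / γ * (ρ k.castSucc * ∏ j ∈ Finset.Ioi k.castSucc, x j) ≤
      ε / M * Y := by
    have hsplit : Y = (∏ j ∈ Finset.Iic k.castSucc, x j) * ∏ j ∈ Finset.Ioi k.castSucc, x j := by
      rw [hY, ← Finset.prod_mul_prod_compl (Finset.Iic k.castSucc)]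
      congr 2
      ext j; simp
    have hQ : 0 < ∏ j ∈ Finset.Ioi k.castSucc, x j := Finset.prod_pos fun j _ => hx j
    rw [hsplit]
    calc γth / γ * (ρ k.castSucc * ∏ j ∈ Finset.Ioi k.castSucc, x j)
        = ε / M * ((ρ k.castSucc * M / ε * (γth / γ)) * ∏ j ∈ Finset.Ioi k.castSucc, x j) := by
          field_simp
      _ ≤ _ := by gcongr; exact h2 k
  have hlast : γth / γ * ρ (Fin.last M) ≤ (1 - ε) * Y := by
    rw [div_mul_eq_mul_div, div_le_iff₀ (by linarith)] at h1
    linarith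
  have hsum : γth / γ * (∑ n, ρ n * ∏ j ∈ Finset.Ioi n, x j) ≤ Y := by
    have he : Finset.Ioi (Fin.last M) = ∅ := by
      ext j; simpa using Fin.le_last j
    rw [Fin.sum_univ_castSucc, mul_add, Finset.mul_sum, he, Finset.prod_empty, mul_one]
    have := Finset.sum_le_sum fun (k : Fin M) (_ : k ∈ Finset.univ) => hk k
    rw [Finset.sum_const, Finset.card_univ, Fintype.card_fin, nsmul_eq_mul] at this
    have e : (M : ℝ) * (ε / M * Y) = ε * Y := by field_simp
    rw [e] at this
    linarith
  rw [div_mul_eq_mul_div, div_lt_iff₀ hD0, ← lt_div_iff₀ hγ, mul_div_right_comm] at h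
  exact absurd h (not_lt.2 hsum)

end Outage

/-! ### Squeezing the outage probability -/

section Asymptotics

variable {Ω : Type*} [MeasurableSpace Ω] {P : Measure Ω} [IsProbabilityMeasure P]
  {M : ℕ} {A ρ : Fin (M + 1) → ℝ} {h : Fin (M + 1) → Ω → ℂ} {γth : ℝ}

lemma le_outage (hρ : ∀ n, 0 < ρ n) (hγth : 0 < γth)
    (hpos : ∀ᵐ ω ∂P, ∀ n, 0 < hopPower A h n ω) {γ : ℝ} (hγ : 0 < γ) :
    P.real {ω | ∏ n, hopPower A h n ω < ρ (Fin.last M) * (γth / γ)} ≤ outage P A ρ h γth γ := by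
  refine ENNReal.toReal_mono (measure_ne_top _ _) (measure_mono_ae ?_)
  filter_upwards [hpos] with ω hω h1
  exact prod_lt_of_prod_lt hω hρ hγ hγth h1

lemma outage_le (hρ : ∀ n, 0 < ρ n) (hγth : 0 < γth) (hM : 1 ≤ M)
    (hpos : ∀ᵐ ω ∂P, ∀ n, 0 < hopPower A h n ω) {γ ε : ℝ} (hγ : 0 < γ) (hε : 0 < ε) (hε1 : ε < 1) :
    outage P A ρ h γth γ ≤
      P.real {ω | ∏ n, hopPower A h n ω < ρ (Fin.last M) / (1 - ε) * (γth / γ)} +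
        ∑ k : Fin M, P.real {ω | ∏ j ∈ Finset.Iic k.castSucc, hopPower A h j ω <
          ρ k.castSucc * M / ε * (γth / γ)} := by
  have h1 : outage P A ρ h γth γ ≤
      P.real ({ω | ∏ n, hopPower A h n ω < ρ (Fin.last M) / (1 - ε) * (γth / γ)} ∪
        ⋃ k : Fin M, {ω | ∏ j ∈ Finset.Iic k.castSucc, hopPower A h j ω <
          ρ k.castSucc * M / ε * (γth / γ)}) := by
    refine ENNReal.toReal_mono (measure_ne_top _ _) (measure_mono_ae ?_)
    filter_upwards [hpos] with ω hω h1
    rcases exists_prod_lt_of_snr_lt hω hρ hγ hγth hM hε hε1 h1 with h2 | ⟨k, h2⟩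
    · exact Or.inl h2
    · exact Or.inr (Set.mem_iUnion.2 ⟨k, h2⟩)
  exact h1.trans ((measureReal_union_le _ _).trans
    (add_le_add le_rfl (measureReal_iUnion_fintype_le _)))

lemma tendsto_outage_div {f : Fin (M + 1) → ℝ → ℝ} {c : Fin (M + 1) → ℝ} (hM : 1 ≤ M)
    (hρ : ∀ n, 0 < ρ n) (hγth : 0 < γth) (hf : ∀ n, IsPowerDensity (f n) (c n))
    (hlaw : ∀ n, HasLaw (hopPower A h n) (volume.withDensity fun x => ENNReal.ofReal (f n x)) P)
    (hindep : iIndepFun (fun n => hopPower A h n) P) :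
    Tendsto (fun γ => outage P A ρ h γth γ / (γth / γ * (-Real.log (γth / γ)) ^ M)) atTop
      (𝓝 (ρ (Fin.last M) * ((∏ n, c n) / (M.factorial : ℝ)))) := by
  have hpos : ∀ᵐ ω ∂P, ∀ n, 0 < hopPower A h n ω :=
    ae_all_iff.2 fun n => ae_pos_of_hasLaw (hf n) (hlaw n)
  have ht : Tendsto (fun γ : ℝ => γth / γ) atTop (𝓝[>] 0) := by
    refine tendsto_nhdsWithin_iff.2 ⟨tendsto_const_nhds.div_atTop tendsto_id, ?_⟩
    filter_upwards [eventually_gt_atTop 0] with γ hγ using div_pos hγth hγ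
  have hfull := logTail_prod hf hlaw hindep (s := Finset.univ) ⟨0, Finset.mem_univ _⟩ M (by simp)
  -- The first `k + 1` powers yield only `k < M` logarithms, so these terms vanish at the scale of
  -- the full product.
  have hpart (k : Fin M) := (logTail_prod hf hlaw hindep (s := Finset.Iic k.castSucc)
    ⟨_, Finset.mem_Iic.2 le_rfl⟩ k (by simp)).lower_order k.2
  set C := (∏ n, c n) / (M.factorial : ℝ)
  have hb : Tendsto (fun ε : ℝ => ρ (Fin.last M) / (1 - ε) * C + 0) (𝓝[>] 0)
      (𝓝 (ρ (Fin.last M) * C)) := by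
    have : ContinuousAt (fun ε : ℝ => ρ (Fin.last M) / (1 - ε) * C + 0) 0 := by
      refine ContinuousAt.add (ContinuousAt.mul (ContinuousAt.div continuousAt_const
        (continuousAt_const.sub continuousAt_id) (by simp)) continuousAt_const) continuousAt_const
    have := this.tendsto
    simp only [sub_zero, div_one, add_zero] at this
    simpa only [add_zero] using this.mono_left nhdsWithin_le_nhds
  refine tendsto_of_forall_squeeze (a := fun _ => ρ (Fin.last M) * C) tendsto_const_nhds hb ?_
  filter_upwards [self_mem_nhdsWithin, mem_nhdsWithin_of_mem_nhds (Iio_mem_nhds zero_lt_one)]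
    with ε hε hε1
  replace hε : 0 < ε := hε
  have hM0 : (0 : ℝ) < M := by exact_mod_cast hM
  have hsum := tendsto_finsetSum (Finset.univ : Finset (Fin M)) fun k _ =>
    ((hpart k).comp_const_mul (div_pos (mul_pos (hρ k.castSucc) hM0) hε)).comp ht
  simp only [mul_zero, Finset.sum_const_zero] at hsum
  refine ⟨_, _, ((hfull.comp_const_mul (div_pos (hρ (Fin.last M)) (sub_pos.2 hε1))).comp ht).add
    hsum, (hfull.comp_const_mul (hρ (Fin.last M))).comp ht, ?_⟩
  filter_upwards [eventually_gt_atTop 0,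
    ht.eventually (tendsto_neg_log_nhdsGT_zero.eventually_gt_atTop 0)] with γ hγ hl
  have hp : 0 < γth / γ * (-Real.log (γth / γ)) ^ M := mul_pos (div_pos hγth hγ) (pow_pos hl _)
  simp only [Function.comp_apply]
  rw [← Finset.sum_div, ← add_div, div_le_div_iff_of_pos_right hp, div_le_div_iff_of_pos_right hp]
  exact ⟨le_outage hρ hγth hpos hγ, outage_le hρ hγth hM hpos hγ hε hε1⟩

end Asymptotics

/-! ### The expansion and its leading term -/

section Leading

variable {M : ℕ} {ρ q θ : Fin (M + 1) → ℝ} {γth : ℝ}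

/-- Here `λ_M = 0` forces every entry to vanish, and `1 ≤ L k` admits the zero vector. -/
lemma indexSet_last {L : Fin M → ℕ} (hL : ∀ k, 1 ≤ L k) : indexSet L (M + 1) = {0} := by
  ext ℓ
  simp only [indexSet, Finset.mem_filter, Fintype.mem_piFinset, Finset.mem_range,
    Nat.add_sub_cancel, Finset.mem_singleton]
  constructor
  · rintro ⟨-, h, -⟩
    funext k
    exact (Finset.sum_eq_zero_iff.1 h) k (by simp)
  · rintro rfl
    exact ⟨fun k => hL k, lam_zero M, fun h => absurd h (by omega)⟩

lemma tendsto_log_pow_ratio {p : ℕ} (hp : p ≤ M) :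
    Tendsto (fun γ : ℝ => Real.log γ ^ p / γ / (Real.log γ ^ M / γ)) atTop
      (𝓝 (if p = M then 1 else 0)) := by
  have key : Tendsto (fun γ : ℝ => ((Real.log γ)⁻¹) ^ (M - p)) atTop
      (𝓝 (if p = M then 1 else 0)) := by
    split_ifs with h
    · simp [h]
    · have := (tendsto_inv_atTop_zero.comp Real.tendsto_log_atTop).pow (M - p)
      rwa [zero_pow (by omega)] at this
  refine key.congr' ?_
  filter_upwards [eventually_gt_atTop 1] with γ hγ
  have hl := (Real.log_pos hγ).ne'
  have hγ0 : γ ≠ 0 := by positivity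
  rw [div_div_div_cancel_right₀ hγ0, inv_pow, ← one_div, div_eq_div_iff (pow_ne_zero _ hl)
    (pow_ne_zero _ hl), one_mul, ← pow_add, Nat.add_sub_cancel' hp]

lemma scale_mul_chi_zero (hq : ∀ n, 0 < q n) (hθ : ∀ n, 0 < θ n) :
    scale ρ q θ γth * chi ρ q θ 0 =
      ρ (Fin.last M) * γth * ∏ n, (1 + q n ^ 2) / (2 * q n * θ n) := by
  have hchi : chi ρ q θ 0 = ∏ n, 2 * q n / (1 + q n ^ 2) := by
    simp only [chi, lam_zero, Fin.prod_univ_castSucc, Pi.zero_apply, pow_zero, mul_zero, add_zero,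
      pow_one, Nat.factorial_zero, Nat.cast_one, div_one, one_mul]
    ring
  rw [hchi, scale, mul_div_assoc, mul_assoc (ρ (Fin.last M) * γth), ← Finset.prod_div_distrib,
    ← Finset.prod_mul_distrib]
  congr 1
  refine Finset.prod_congr rfl fun n _ => ?_
  have := (hq n).ne'
  have := (hθ n).ne'
  have : 1 + q n ^ 2 ≠ 0 := by positivity
  field_simp
  ring

lemma tendsto_expansion_div (hq : ∀ n, 0 < q n) (hθ : ∀ n, 0 < θ n)
    {L : Fin M → ℕ} (hL : ∀ k, 1 ≤ L k) :
    Tendsto (fun γ => expansion ρ q θ γth L γ / (Real.log γ ^ M / γ)) atTop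
      (𝓝 (ρ (Fin.last M) * γth / (M.factorial : ℝ) *
        ∏ n, (1 + q n ^ 2) / (2 * q n * θ n))) := by
  have hlim : Tendsto (fun γ => expansion ρ q θ γth L γ / (Real.log γ ^ M / γ)) atTop
      (𝓝 (scale ρ q θ γth *
        ∑ r ∈ Finset.Icc 1 (M + 1), ∑ ℓ ∈ indexSet L r,
          (-1) ^ lam ℓ M * chi ρ q θ ℓ *
            ∑ l ∈ Finset.range r,
              etaDeriv q ℓ r (r - 1 - l) / (((r - 1 - l).factorial : ℝ) * (l.factorial : ℝ)) *
                ∑ p ∈ Finset.range (l + 1),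
                  (l.choose p : ℝ) * (-1) ^ p * Real.log (scale ρ q θ γth) ^ (l - p) *
                    (if p = M then 1 else 0))) := by
    simp only [expansion, mul_div_assoc, Finset.sum_div]
    refine Tendsto.const_mul _ (tendsto_finsetSum _ fun r hr => tendsto_finsetSum _ fun ℓ _ =>
      Tendsto.const_mul _ (tendsto_finsetSum _ fun l hl => Tendsto.const_mul _
        (tendsto_finsetSum _ fun p hp => Tendsto.const_mul _ (tendsto_log_pow_ratio ?_))))
    rw [Finset.mem_Icc] at hr
    rw [Finset.mem_range] at hl hp
    omega
  convert hlim using 2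
  rw [Finset.sum_eq_single_of_mem (M + 1) (by simp), indexSet_last hL, Finset.sum_singleton,
    Finset.sum_eq_single_of_mem M (by simp), Finset.sum_eq_single_of_mem M (by simp)]
  -- The sign of `etaDeriv_zero` cancels the `(-1) ^ p` of the binomial sum at `p = M`.
  · have hs : ((-1 : ℝ) ^ M) * (-1) ^ M = 1 := by rw [← mul_pow]; simp
    simp only [lam_zero, pow_zero, one_mul, Nat.add_sub_cancel, Nat.sub_self, etaDeriv_zero hq,
      Nat.factorial_zero, Nat.cast_one, Nat.choose_self, if_true, mul_one]
    rw [div_mul_eq_mul_div ((-1 : ℝ) ^ M), hs, ← mul_assoc (scale ρ q θ γth),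
      scale_mul_chi_zero hq hθ]
    ring
  · intro p _ hp
    rw [if_neg hp, mul_zero]
  · intro l hl hlM
    rw [Finset.mem_range] at hl
    refine mul_eq_zero_of_right _ (Finset.sum_eq_zero fun p hp => ?_)
    rw [Finset.mem_range] at hp
    rw [if_neg (by omega), mul_zero]
  · intro r hr hrM
    rw [Finset.mem_Icc] at hr
    refine Finset.sum_eq_zero fun ℓ _ => mul_eq_zero_of_right _ (Finset.sum_eq_zero fun l hl =>
      mul_eq_zero_of_right _ (Finset.sum_eq_zero fun p hp => ?_))
    rw [Finset.mem_range] at hl hp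
    rw [if_neg (by omega), mul_zero]

lemma isEquivalent_leading_of_tendsto {u : ℝ → ℝ} (hρ : ∀ n, 0 < ρ n) (hq : ∀ n, 0 < q n)
    (hθ : ∀ n, 0 < θ n) (hγth : 0 < γth)
    (hu : Tendsto (fun γ => u γ / (Real.log γ ^ M / γ)) atTop
      (𝓝 (ρ (Fin.last M) * γth / (M.factorial : ℝ) *
        ∏ n, (1 + q n ^ 2) / (2 * q n * θ n)))) :
    u ~[atTop] leading ρ q θ γth := by
  set K := ρ (Fin.last M) * γth / (M.factorial : ℝ) *
        ∏ n, (1 + q n ^ 2) / (2 * q n * θ n) with hK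
  have hK0 : K ≠ 0 := by
    have := hρ (Fin.last M)
    refine mul_ne_zero (by positivity) (Finset.prod_ne_zero_iff.2 fun n _ => ?_)
    have := hq n
    have := hθ n
    positivity
  refine isEquivalent_of_tendsto_one ?_
  have h := hu.div_const K
  rw [div_self hK0] at h
  refine h.congr fun γ => ?_
  rw [Pi.div_apply, leading, ← hK, div_div, mul_comm K]

end Leading

end HoytRelay

theorem mainTheorem6 {Ω : Type*} [MeasurableSpace Ω] (P : Measure Ω) [IsProbabilityMeasure P]
    (M : ℕ) (hM : 1 ≤ M)
    (A ρ q θ : Fin (M + 1) → ℝ) (γth : ℝ) (h : Fin (M + 1) → Ω → ℂ)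
    (hρ : ∀ n, 0 < ρ n) (hq : ∀ n, 0 < q n) (hθ : ∀ n, 0 < θ n) (hγth : 0 < γth)
    (hlaw : ∀ n, HasLaw (HoytRelay.hopPower A h n) (HoytRelay.hoytMeasure (q n) (θ n)) P)
    (hindep : iIndepFun (fun n => HoytRelay.hopPower A h n) P)
    (L : Fin M → ℕ) (hL : ∀ k, 1 ≤ L k) :
    (∀ r ∈ Finset.Icc 1 (M + 1), ∀ ℓ ∈ HoytRelay.indexSet L r, ∀ k < r,
      Tendsto (iteratedDeriv k (HoytRelay.eta q ℓ r)) (𝓝[≠] (1 : ℝ))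
        (𝓝 (HoytRelay.etaDeriv q ℓ r k))) ∧
    (fun γ : ℝ => HoytRelay.outage P A ρ h γth γ) ~[atTop]
      (fun γ : ℝ => HoytRelay.expansion ρ q θ γth L γ) ∧
    (fun γ : ℝ => HoytRelay.outage P A ρ h γth γ) ~[atTop]
      (fun γ : ℝ => HoytRelay.leading ρ q θ γth γ) := by
  have hf (n) : HoytRelay.IsPowerDensity (HoytRelay.hoytPDF (q n) (θ n))
      ((1 + q n ^ 2) / (2 * q n * θ n)) := by
    have : IsProbabilityMeasure (HoytRelay.hoytMeasure (q n) (θ n)) := by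
      rw [← (hlaw n).map_eq]
      exact Measure.isProbabilityMeasure_map (hlaw n).aemeasurable
    exact HoytRelay.isPowerDensity_hoytPDF (hq n) (hθ n)
  have hout : Tendsto (fun γ => HoytRelay.outage P A ρ h γth γ / (Real.log γ ^ M / γ)) atTop
      (𝓝 (ρ (Fin.last M) * γth / (M.factorial : ℝ) *
        ∏ n, (1 + q n ^ 2) / (2 * q n * θ n))) := by
    have h1 := HoytRelay.tendsto_outage_div hM hρ hγth hf hlaw hindep
    have hinv : Tendsto (fun γ : ℝ => γ⁻¹) atTop (𝓝[>] 0) := tendsto_inv_atTop_nhdsGT_zero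
    -- With `δ = γth⁻¹` and `t = γ⁻¹` this says `-log (γth / γ) ∼ log γ`, which changes the
    -- normalization to `Real.log γ ^ M / γ`.
    have h2 := (((HoytRelay.tendsto_log_div_div_neg_log (inv_pos.2 hγth)).comp hinv).pow
      M).const_mul γth
    have h3 := h1.mul h2
    rw [one_pow, mul_one] at h3
    convert h3.congr' ?_ using 2
    · ring
    filter_upwards [eventually_gt_atTop 1, eventually_gt_atTop γth] with γ hγ hγ'
    have hγ0 : 0 < γ := by positivity
    have hl := (pow_pos (Real.log_pos hγ) M).ne'
    have e1 : Real.log (γth⁻¹ / γ⁻¹) = -Real.log (γth / γ) := by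
      rw [← Real.log_inv]; congr 1; field_simp
    have hl' : (-Real.log (γth / γ)) ^ M ≠ 0 := by
      refine (pow_pos (neg_pos.2 (Real.log_neg (div_pos hγth hγ0) ?_)) M).ne'
      rwa [div_lt_one hγ0]
    rw [Function.comp_apply, e1, Real.log_inv, neg_neg, div_pow]
    field_simp
  have hlead := HoytRelay.isEquivalent_leading_of_tendsto hρ hq hθ hγth hout
  exact ⟨fun r hr ℓ hℓ k _ => HoytRelay.tendsto_iteratedDeriv_eta hq hr hℓ k,
    hlead.trans (HoytRelay.isEquivalent_leading_of_tendsto hρ hq hθ hγth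
      (HoytRelay.tendsto_expansion_div hq hθ hL)).symm, hlead⟩
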